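/- Let $R>0$ and let $S\subseteq\mathbb{R}^2$ be a closed convex set that contains a closed disc of radius $R$. Consider the following zero-sum game (the secure localization game on the surface $S$ with power range $R$ and the maximum deception criterion). The verifiers $\mathbf{v}$ choose a triple $\langle V_1,V_2,V_3\rangle$ of points of $S$ with $\overline{V_iV_j}\le R$ for all $i,j$; the malicious node $\mathbf{m}$ chooses a pair $\langle U,P\rangle$ of points of $S$. If $$\overline{PV_i}<R\quad\text{and}\quad \overline{PV_i}>\overline{UV_i}\qquad\text{for } i=1,2,3$$ (the outcome is UNKNOWN), then $u_{\mathbf{m}}=\overline{UP}$; otherwise $u_{\mathbf{m}}=0$; and $u_{\mathbf{v}}=-u_{\mathbf{m}}$. Mixed strategies are Borel probability measures on the action spaces, each player maximizes its own expected utility, and $\operatorname{supp}(\sigma_i)$ denotes the (topological) support of the strategy $\sigma_i$, i.e. the set of actions each neighbourhood of which is played with positive probability. Then in every Nash equilibrium $\sigma=(\sigma_{\mathbf{v}},\sigma_{\mathbf{m}})$ both $\operatorname{supp}(\sigma_{\mathbf{v}})$ and $\operatorname{supp}(\sigma_{\mathbf{m}})$ are infinite: neither player randomizes over finitely many actions only.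 -/

import Mathlib

open MeasureTheory

noncomputable section

namespace SecureLocalization

/-- The Euclidean plane. -/
abbrev Plane : Type := EuclideanSpace ℝ (Fin 2)

/-- The pure actions of the verifiers: triples `⟨V₁, V₂, V₃⟩` of positions in the surface `S`
whose mutual distances do not exceed the power range `R`. -/
abbrev VerifierAction (S : Set Plane) (R : ℝ) : Type :=
  {V : Fin 3 → Plane // (∀ i, V i ∈ S) ∧ ∀ i j, dist (V i) (V j) ≤ R}

/-- The pure actions of the malicious node: pairs `⟨U, P⟩` of a real position `U ∈ S` and
a pretended position `P ∈ S`. -/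
abbrev MaliciousAction (S : Set Plane) : Type := S × S

/-- `P` is a plausible falsification of `U` with respect to the verifiers `V`: it is in the power
range of every verifier and strictly farther than `U` from every verifier. These are the profiles
with outcome UNKNOWN. (Then `P` is automatically outside the triangle of the verifiers, which all
lie in the open half-plane of the points closer to `U` than to `P`.) -/
def IsUnknown (R : ℝ) (V : Fin 3 → Plane) (U P : Plane) : Prop :=
  ∀ i, dist P (V i) < R ∧ dist U (V i) < dist P (V i)

open Classical in
/-- The utility of the malicious node under the maximum deception criterion: the distance between
the real and the pretended position if the outcome is UNKNOWN, and zero otherwise. -/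
def utilityM {S : Set Plane} {R : ℝ} (a : VerifierAction S R) (b : MaliciousAction S) : ℝ :=
  if IsUnknown R a.1 b.1 b.2 then dist (b.1 : Plane) (b.2 : Plane) else 0

/-- The utility of the verifiers: the game is zero-sum. -/
def utilityV {S : Set Plane} {R : ℝ} (a : VerifierAction S R) (b : MaliciousAction S) : ℝ :=
  -utilityM a b

/-- Expectation of a utility function when the players randomize independently. -/
def expected {S : Set Plane} {R : ℝ} (u : VerifierAction S R → MaliciousAction S → ℝ)
    (σv : ProbabilityMeasure (VerifierAction S R))
    (σm : ProbabilityMeasure (MaliciousAction S)) : ℝ :=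
  ∫ x, u x.1 x.2 ∂((σv : Measure (VerifierAction S R)).prod (σm : Measure (MaliciousAction S)))

/-- Nash equilibrium in mixed strategies (Borel probability measures on the action spaces):
no player can improve its own expected utility by deviating unilaterally. -/
def IsEquilibrium {S : Set Plane} {R : ℝ}
    (σv : ProbabilityMeasure (VerifierAction S R))
    (σm : ProbabilityMeasure (MaliciousAction S)) : Prop :=
  (∀ τ : ProbabilityMeasure (VerifierAction S R),
      expected utilityV τ σm ≤ expected utilityV σv σm) ∧
  (∀ τ : ProbabilityMeasure (MaliciousAction S),
      expected utilityM σv τ ≤ expected utilityM σv σm)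

end SecureLocalization

end

noncomputable section

namespace SecureLocalization

open Filter Topology Set

/-! Let `w` be the equilibrium payoff of the malicious node. UNKNOWN is an open condition and forces
`dist U P < 2 * R`. Such a pair can be stretched inside `S` by an arbitrarily small move: pull `U`
and `P` towards opposite ends of the diameter of the disc parallel to `P - U`
(`exists_tendsto_dist_lt`).

Against finitely many triples, a small enough stretch of a pair earning at least `w` loses no
UNKNOWN outcome and earns more than `w`. If instead the malicious node plays finitely many pairs,
stretch them all; compactness of the space of triples makes one stretch earn more than `w` against
every triple. Both are absurd once `w > 0`, which holds because every triple is defeated by some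
pair (`exists_isUnknown`): leave the triangle at a point closer than `R` to all vertices, take `P`
just outside, and project it back to get `U`. -/

/-! ### Convex geometry of the plane -/

/-- A nonempty open set of the plane has a point that is on none of finitely many given lines
through a given point. -/
theorem exists_mem_open_notMem_line {ι : Type*} [Countable ι] {G : Set Plane} (hG : IsOpen G)
    (hne : G.Nonempty) (Z : Plane) (V : ι → Plane) : ∃ Q ∈ G, ∀ i, Q ∉ line[ℝ, Z, V i] := by
  by_contra! h
  have hsub : G ⊆ ⋃ i, (line[ℝ, Z, V i] : Set Plane) := fun Q hQ => by
    obtain ⟨i, hi⟩ := h Q hQ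
    exact mem_iUnion.2 ⟨i, hi⟩
  have hnull : volume (⋃ i, (line[ℝ, Z, V i] : Set Plane)) = 0 := by
    refine measure_iUnion_null fun i => Measure.addHaar_affineSubspace _ _ fun htop => ?_
    have h1 : Module.finrank ℝ (line[ℝ, Z, V i]).direction ≤ 1 := by
      rw [direction_affineSpan]
      exact collinear_iff_finrank_le_one.1 (collinear_pair ℝ Z (V i))
    rw [htop, AffineSubspace.direction_top, finrank_top, finrank_euclideanSpace_fin] at h1
    omega
  exact (hG.measure_pos volume hne).ne' (measure_mono_null hsub hnull)

/-- A closed ball of a strictly convex space touches the convex hull of a set inside it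
only at points of that set. -/
theorem dist_lt_of_mem_convexHull {E : Type*} [NormedAddCommGroup E] [NormedSpace ℝ E]
    [StrictConvexSpace ℝ E] {A : Set E} {x y : E} {r : ℝ} (hr : r ≠ 0)
    (hA : A ⊆ Metric.closedBall y r) (hx : x ∈ convexHull ℝ A) (hxA : x ∉ A) : dist x y < r := by
  have hsub : convexHull ℝ A ⊆ Metric.closedBall y r := convexHull_min hA (convex_closedBall y r)
  -- A point on the sphere is extreme in the ball, hence extreme in the hull, hence in `A`.
  refine lt_of_le_of_ne (hsub hx) fun h => hxA (extremePoints_convexHull_subset (𝕜 := ℝ) ?_)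
  exact inter_extremePoints_subset_extremePoints_of_subset hsub
    ⟨hx, StrictConvexSpace.sphere_subset_extremePoints_closedBall y hr h⟩

/-- A point outside a compact convex set is farther from every point of the set
than its projection to the set is. -/
theorem exists_dist_lt_of_notMem {E : Type*} [NormedAddCommGroup E] [InnerProductSpace ℝ E]
    {T : Set E} (hT : IsCompact T) (hconv : Convex ℝ T) (hne : T.Nonempty) {P : E} (hP : P ∉ T) :
    ∃ U ∈ T, ∀ x ∈ T, dist U x < dist P x := by
  obtain ⟨U, hU, hmin⟩ := exists_norm_eq_iInf_of_complete_convex hne hT.isComplete hconv P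
  rw [norm_eq_iInf_iff_real_inner_le_zero hconv hU] at hmin
  refine ⟨U, hU, fun x hx => ?_⟩
  have hPU : 0 < ‖P - U‖ := norm_pos_iff.2 (sub_ne_zero.2 fun h => hP (h ▸ hU))
  have h1 := norm_sub_sq_real (P - U) (x - U)
  rw [sub_sub_sub_cancel_right] at h1
  rw [dist_comm U, dist_eq_norm, dist_eq_norm]
  refine lt_of_pow_lt_pow_left₀ 2 (norm_nonneg _) ?_
  nlinarith [hmin x hx]

/-- The segment from a point of a compact set to a point outside leaves the set for good at
a last point. -/
theorem exists_last_mem {E : Type*} [NormedAddCommGroup E] [NormedSpace ℝ E] {T : Set E}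
    (hT : IsClosed T) {Z Q : E} (hZ : Z ∈ T) (hQ : Q ∉ T) :
    ∃ s : ℝ, 0 ≤ s ∧ s < 1 ∧ AffineMap.lineMap Z Q s ∈ T ∧
      ∀ t, s < t → t ≤ 1 → AffineMap.lineMap Z Q t ∉ T := by
  have hcont : Continuous fun t : ℝ => AffineMap.lineMap Z Q t := AffineMap.lineMap_continuous
  have hK : IsCompact (Icc (0 : ℝ) 1 ∩ (fun t : ℝ => AffineMap.lineMap Z Q t) ⁻¹' T) :=
    isCompact_Icc.inter_right (hT.preimage hcont)
  obtain ⟨s, ⟨hs, hsT⟩, hmax⟩ := hK.exists_isGreatest ⟨0, by simp, by simpa using hZ⟩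
  refine ⟨s, hs.1, lt_of_le_of_ne hs.2 ?_, hsT, fun t hst ht hmem => ?_⟩
  · rintro rfl
    exact hQ (by simpa using hsT)
  · exact absurd (hmax ⟨⟨hs.1.trans hst.le, ht⟩, hmem⟩) (not_le.2 hst)

/-- Every action of the verifiers is defeated by some action of the malicious node. -/
theorem exists_isUnknown {R : ℝ} (hR : 0 < R) {S : Set Plane} (hconvex : Convex ℝ S) {c : Plane}
    (hc : Metric.closedBall c R ⊆ S) (V : VerifierAction S R) :
    ∃ b : MaliciousAction S, IsUnknown R V.1 b.1 b.2 := by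
  obtain ⟨V, hVS, hVR⟩ := V
  set T : Set Plane := convexHull ℝ (range V) with hTdef
  have hTc : IsCompact T := (finite_range V).isCompact_convexHull ℝ
  have hTS : T ⊆ S := convexHull_min (range_subset_iff.2 hVS) hconvex
  have hVT : ∀ i, V i ∈ T := fun i => subset_convexHull ℝ _ (mem_range_self i)
  set Z : Plane := (1 / 3 : ℝ) • (V 0 + V 1 + V 2) with hZdef
  have hZT : Z ∈ T := by
    have := (convex_convexHull ℝ (range V)).sum_mem (t := Finset.univ)
      (w := fun _ : Fin 3 => (1 / 3 : ℝ)) (z := V) (by simp) (by simp) (fun i _ => hVT i)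
    simpa [Fin.sum_univ_three, hZdef, smul_add] using this
  have hZV : ∀ i, dist Z (V i) ≤ 2 / 3 * R := by
    intro i
    have e : Z - V i = (1 / 3 : ℝ) • ((V 0 - V i) + (V 1 - V i) + (V 2 - V i)) := by
      rw [hZdef]; module
    have h (j) : ‖V j - V i‖ ≤ R := by simpa [dist_eq_norm] using hVR j i
    rw [dist_eq_norm, e, norm_smul, Real.norm_of_nonneg (by norm_num)]
    have : ‖(V 0 - V i) + (V 1 - V i) + (V 2 - V i)‖ ≤ 2 * R := by
      refine norm_add₃_le.trans ?_
      fin_cases i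
      · have := h 1; have := h 2; simp at *; linarith
      · have := h 0; have := h 2; simp at *; linarith
      · have := h 0; have := h 1; simp at *; linarith
    linarith
  have hTZ : T ⊆ Metric.closedBall Z (2 / 3 * R) :=
    convexHull_min (range_subset_iff.2 fun i => by simpa [dist_comm] using hZV i)
      (convex_closedBall _ _)
  -- Avoiding the lines through `Z` and the vertices keeps the exit point from being a vertex, whose
  -- distance to another vertex may equal `R`.
  obtain ⟨Q, ⟨hQc, hQZ⟩, hQ⟩ := exists_mem_open_notMem_line
    (G := Metric.ball c R ∩ (Metric.closedBall Z (2 / 3 * R))ᶜ)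
    (Metric.isOpen_ball.inter Metric.isClosed_closedBall.isOpen_compl) (by
      obtain ⟨e, he⟩ := exists_norm_eq Plane (zero_le_one (α := ℝ))
      by_contra hempty
      have key : ∀ s : ℝ, |s| < R → dist (c + s • e) Z ≤ 2 / 3 * R := by
        intro s hs
        by_contra hlt
        exact hempty ⟨c + s • e, by simpa [dist_eq_norm, norm_smul, he] using hs,
          by simpa using hlt⟩
      -- Two points of the disc `3 / 2 * R` apart cannot both lie in a ball of diameter `4 / 3 * R`.
      have h1 := key (3 / 4 * R) (by rw [abs_of_pos (by positivity)]; linarith)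
      have h2 := key (-(3 / 4 * R)) (by rw [abs_neg, abs_of_pos (by positivity)]; linarith)
      have h3 : dist (c + (3 / 4 * R) • e) (c + (-(3 / 4 * R)) • e) = 3 / 2 * R := by
        rw [dist_eq_norm, show c + (3 / 4 * R) • e - (c + (-(3 / 4 * R)) • e) = (3 / 2 * R) • e by
          module, norm_smul, he, Real.norm_of_nonneg (by positivity), mul_one]
      have h4 := dist_triangle_right (c + (3 / 4 * R) • e) (c + (-(3 / 4 * R)) • e) Z
      linarith) Z V
  have hQS : Q ∈ S := hc (Metric.ball_subset_closedBall hQc)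
  obtain ⟨s, hs0, hs1, hsT, hslast⟩ := exists_last_mem hTc.isClosed hZT fun h => hQZ (hTZ h)
  have hXV : ∀ i, dist (AffineMap.lineMap Z Q s) (V i) < R := by
    intro i
    rcases hs0.eq_or_lt with rfl | hspos
    · simpa using (hZV i).trans_lt (by linarith)
    · refine dist_lt_of_mem_convexHull hR.ne' (range_subset_iff.2 fun j => hVR j i) hsT ?_
      rintro ⟨j, hj⟩
      refine hQ j ?_
      have : Q = AffineMap.lineMap Z (V j) s⁻¹ := by
        rw [hj, AffineMap.lineMap_apply, AffineMap.lineMap_apply, vadd_vsub, smul_smul,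
          inv_mul_cancel₀ hspos.ne', one_smul, vsub_vadd]
      rw [this]
      exact AffineMap.lineMap_mem_affineSpan_pair _ _ _
  have hnear : ∀ᶠ t in 𝓝[>] s, ∀ i, dist (AffineMap.lineMap Z Q t) (V i) < R := by
    refine nhdsWithin_le_nhds (eventually_all.2 fun i => ?_)
    have hcont : Continuous fun t : ℝ => dist (AffineMap.lineMap Z Q t) (V i) :=
      AffineMap.lineMap_continuous.dist continuous_const
    exact hcont.continuousAt.eventually_lt_const (hXV i)
  obtain ⟨t, htR, hst, ht1⟩ := (hnear.and (Ioc_mem_nhdsGT hs1)).exists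
  obtain ⟨U, hUT, hU⟩ := exists_dist_lt_of_notMem hTc (convex_convexHull ℝ _) ⟨Z, hZT⟩
    (hslast t hst ht1)
  have hPS : AffineMap.lineMap Z Q t ∈ S :=
    hconvex.lineMap_mem (hTS hZT) hQS ⟨hs0.trans hst.le, ht1⟩
  exact ⟨(⟨U, hTS hUT⟩, ⟨_, hPS⟩), fun i => ⟨htR i, hU _ (hVT i)⟩⟩

/-- In a convex set with a disc of radius `R`, a pair of points at distance less than `2 * R` is
never a local maximum of the distance. -/
theorem exists_tendsto_dist_lt {R : ℝ} (hR : 0 < R) {S : Set Plane} (hconvex : Convex ℝ S)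
    {c : Plane} (hc : Metric.closedBall c R ⊆ S) (b : MaliciousAction S) :
    ∃ x : ℕ → MaliciousAction S, Tendsto x atTop (𝓝 b) ∧
      (b.1 ≠ b.2 → dist b.1 b.2 < 2 * R → ∀ n, dist b.1 b.2 < dist (x n).1 (x n).2) := by
  obtain ⟨⟨U, hU⟩, ⟨P, hP⟩⟩ := b
  set d : ℝ := ‖P - U‖ with hd
  have hdR : |R| * |d|⁻¹ * d ≤ R := by
    rw [abs_of_pos hR, mul_assoc, abs_of_nonneg (norm_nonneg _)]
    exact mul_le_of_le_one_right hR.le (inv_mul_le_one)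
  -- Ends of the diameter parallel to `P - U`; if `U = P`, then `d⁻¹ = 0` and both are `c`.
  have hQ : c + (R * d⁻¹) • (P - U) ∈ S := hc (by
    simpa [dist_eq_norm, norm_smul, abs_mul, ← hd] using hdR)
  have hQ' : c - (R * d⁻¹) • (P - U) ∈ S := hc (by
    simpa [dist_eq_norm, norm_smul, abs_mul, ← hd] using hdR)
  set t : ℕ → ℝ := fun n => 1 / ((n : ℝ) + 1) with ht
  have ht0 (n) : 0 < t n := by positivity
  have ht1 (n) : t n ≤ 1 := by
    rw [ht]; exact (div_le_one (by positivity)).2 (by simp)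
  have htlim : Tendsto t atTop (𝓝 0) := tendsto_one_div_add_atTop_nhds_zero_nat
  have hlim (A B : Plane) : Tendsto (fun n => AffineMap.lineMap A B (t n)) atTop (𝓝 A) := by
    have : Continuous fun t : ℝ => AffineMap.lineMap A B t := AffineMap.lineMap_continuous
    simpa [Function.comp_def] using (this.tendsto 0).comp htlim
  refine ⟨fun n => (⟨_, hconvex.lineMap_mem hU hQ' ⟨(ht0 n).le, ht1 n⟩⟩,
    ⟨_, hconvex.lineMap_mem hP hQ ⟨(ht0 n).le, ht1 n⟩⟩), ?_, fun hne hlt n => ?_⟩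
  · exact (tendsto_subtype_rng.2 (hlim _ _)).prodMk_nhds (tendsto_subtype_rng.2 (hlim _ _))
  · have hne' : U ≠ P := fun h => hne (Subtype.ext h)
    have hdpos : 0 < d := norm_pos_iff.2 (sub_ne_zero.2 hne'.symm)
    simp only [Subtype.dist_eq] at hlt ⊢
    rw [dist_comm, dist_eq_norm, ← hd] at hlt ⊢
    rw [dist_comm, dist_eq_norm]
    have e : AffineMap.lineMap P (c + (R * d⁻¹) • (P - U)) (t n)
        - AffineMap.lineMap U (c - (R * d⁻¹) • (P - U)) (t n)
        = ((1 - t n) + 2 * t n * R * d⁻¹) • (P - U) := by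
      simp only [AffineMap.lineMap_apply_module]
      module
    have hnn : 0 ≤ (1 - t n) + 2 * t n * R * d⁻¹ := by
      have := ht1 n; have := ht0 n
      have : 0 ≤ 2 * t n * R * d⁻¹ := by positivity
      linarith
    -- The new distance is `(1 - t n) * d + 2 * t n * R`, which exceeds `d` since `d < 2 * R`.
    rw [e, norm_smul, ← hd, Real.norm_of_nonneg hnn, add_mul, mul_assoc _ d⁻¹ d,
      inv_mul_cancel₀ hdpos.ne']
    nlinarith [ht0 n]

/-! ### Outcome and utility -/

variable {R : ℝ} {S : Set Plane}

theorem isOpen_setOf_isUnknown :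
    IsOpen {x : VerifierAction S R × MaliciousAction S | IsUnknown R x.1.1 x.2.1 x.2.2} := by
  simp only [IsUnknown, ofPred_forall]
  refine isOpen_iInter_of_finite fun i => ?_
  have hV : Continuous fun x : VerifierAction S R × MaliciousAction S => x.1.1 i :=
    (continuous_apply i).comp (continuous_subtype_val.comp continuous_fst)
  have hU : Continuous fun x : VerifierAction S R × MaliciousAction S => (x.2.1 : Plane) :=
    continuous_subtype_val.comp (continuous_fst.comp continuous_snd)
  have hP : Continuous fun x : VerifierAction S R × MaliciousAction S => (x.2.2 : Plane) :=
    continuous_subtype_val.comp (continuous_snd.comp continuous_snd)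
  exact (isOpen_lt (hP.dist hV) continuous_const).inter (isOpen_lt (hU.dist hV) (hP.dist hV))

theorem IsUnknown.ne {V : Fin 3 → Plane} {U P : Plane} (h : IsUnknown R V U P) : U ≠ P := by
  rintro rfl
  exact lt_irrefl _ (h 0).2

theorem IsUnknown.dist_lt {V : Fin 3 → Plane} {U P : Plane} (h : IsUnknown R V U P) :
    dist U P < 2 * R := by
  have := dist_triangle_right U P (V 0)
  linarith [(h 0).1, (h 0).2]

theorem utilityM_of_isUnknown {a : VerifierAction S R} {b : MaliciousAction S}
    (h : IsUnknown R a.1 b.1 b.2) : utilityM a b = dist (b.1 : Plane) b.2 := if_pos h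

theorem utilityM_nonneg (a : VerifierAction S R) (b : MaliciousAction S) : 0 ≤ utilityM a b := by
  unfold utilityM
  split_ifs
  exacts [dist_nonneg, le_rfl]

theorem utilityM_pos_iff {a : VerifierAction S R} {b : MaliciousAction S} :
    0 < utilityM a b ↔ IsUnknown R a.1 b.1 b.2 := by
  refine ⟨fun h => ?_, fun h => ?_⟩
  · by_contra hn
    simp [utilityM, hn] at h
  · rw [utilityM_of_isUnknown h]
    exact dist_pos.2 h.ne

theorem utilityM_le (hR : 0 ≤ R) (a : VerifierAction S R) (b : MaliciousAction S) :
    utilityM a b ≤ 2 * R := by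
  unfold utilityM
  split_ifs with h
  exacts [h.dist_lt.le, by positivity]

theorem measurable_utilityM :
    Measurable fun x : VerifierAction S R × MaliciousAction S => utilityM x.1 x.2 := by
  unfold utilityM
  exact Measurable.ite isOpen_setOf_isUnknown.measurableSet (by fun_prop) measurable_const

theorem integrable_utilityM (hR : 0 ≤ R)
    (μ : Measure (VerifierAction S R × MaliciousAction S)) [IsFiniteMeasure μ] :
    Integrable (fun x => utilityM x.1 x.2) μ :=
  Integrable.of_bound measurable_utilityM.aestronglyMeasurable (2 * R) <| .of_forall fun x => by
    rw [Real.norm_of_nonneg (utilityM_nonneg _ _)]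
    exact utilityM_le hR _ _

theorem integrable_utilityM_left (hR : 0 ≤ R) (b : MaliciousAction S)
    (μ : Measure (VerifierAction S R)) [IsFiniteMeasure μ] :
    Integrable (fun a => utilityM a b) μ :=
  Integrable.of_bound
    (measurable_utilityM.comp (measurable_id.prodMk measurable_const)).aestronglyMeasurable
    (2 * R) <| .of_forall fun x => by
    rw [Real.norm_of_nonneg (utilityM_nonneg _ _)]
    exact utilityM_le hR _ _

theorem expected_utilityV (σv : ProbabilityMeasure (VerifierAction S R))
    (σm : ProbabilityMeasure (MaliciousAction S)) :
    expected utilityV σv σm = -expected utilityM σv σm := integral_neg _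

theorem expected_utilityM_eq (hR : 0 ≤ R) (σv : ProbabilityMeasure (VerifierAction S R))
    (σm : ProbabilityMeasure (MaliciousAction S)) :
    expected utilityM σv σm = ∫ a, ∫ b, utilityM a b ∂(σm : Measure (MaliciousAction S))
      ∂(σv : Measure (VerifierAction S R)) :=
  integral_prod _ (integrable_utilityM hR _)

theorem expected_utilityM_eq_symm (hR : 0 ≤ R) (σv : ProbabilityMeasure (VerifierAction S R))
    (σm : ProbabilityMeasure (MaliciousAction S)) :
    expected utilityM σv σm = ∫ b, ∫ a, utilityM a b ∂(σv : Measure (VerifierAction S R))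
      ∂(σm : Measure (MaliciousAction S)) :=
  integral_prod_symm _ (integrable_utilityM hR _)

/-! ### Equilibrium payoff -/

/-- No pure action of the malicious node beats its equilibrium strategy. -/
theorem IsEquilibrium.integral_le (hR : 0 ≤ R) {σv : ProbabilityMeasure (VerifierAction S R)}
    {σm : ProbabilityMeasure (MaliciousAction S)} (h : IsEquilibrium σv σm)
    (b : MaliciousAction S) :
    ∫ a, utilityM a b ∂(σv : Measure (VerifierAction S R)) ≤ expected utilityM σv σm := by
  refine le_trans (le_of_eq ?_) (h.2 (diracProba b))
  rw [expected_utilityM_eq_symm hR]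
  simp [diracProba]

/-- No pure action of the verifiers beats their equilibrium strategy. -/
theorem IsEquilibrium.le_integral (hR : 0 ≤ R) {σv : ProbabilityMeasure (VerifierAction S R)}
    {σm : ProbabilityMeasure (MaliciousAction S)} (h : IsEquilibrium σv σm)
    (a : VerifierAction S R) :
    expected utilityM σv σm ≤ ∫ b, utilityM a b ∂(σm : Measure (MaliciousAction S)) := by
  have := h.1 (diracProba a)
  rw [expected_utilityV, expected_utilityV, neg_le_neg_iff] at this
  refine this.trans (le_of_eq ?_)
  rw [expected_utilityM_eq hR]
  simp [diracProba]

/-- The malicious node has a positive utility in every equilibrium. -/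
theorem IsEquilibrium.expected_pos (hR : 0 < R) (hconvex : Convex ℝ S) {c : Plane}
    (hc : Metric.closedBall c R ⊆ S) {σv : ProbabilityMeasure (VerifierAction S R)}
    {σm : ProbabilityMeasure (MaliciousAction S)} (h : IsEquilibrium σv σm) :
    0 < expected utilityM σv σm := by
  by_contra! hle
  -- The null set of triples depends on the pair, so only countably many pairs can be treated at
  -- once; openness of UNKNOWN makes a dense set enough.
  obtain ⟨D, hDc, hD⟩ := TopologicalSpace.exists_countable_dense (MaliciousAction S)
  have hae : ∀ᵐ a ∂(σv : Measure (VerifierAction S R)), ∀ b ∈ D, utilityM a b = 0 := by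
    refine (ae_ball_iff hDc).2 fun b _ => ?_
    refine (integral_eq_zero_iff_of_nonneg (fun a => utilityM_nonneg a b)
      (integrable_utilityM_left hR.le b _)).1 (le_antisymm ((h.integral_le hR.le b).trans hle) ?_)
    exact integral_nonneg fun a => utilityM_nonneg a b
  obtain ⟨a, ha⟩ := hae.exists
  obtain ⟨b, hb, hbD⟩ := hD.inter_open_nonempty {b | IsUnknown R a.1 b.1 b.2}
    (isOpen_setOf_isUnknown.preimage (Continuous.prodMk_right a))
    (exists_isUnknown hR hconvex hc a)
  exact (utilityM_pos_iff.2 hb).ne' (ha b hbD)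

/-! ### Finite supports are impossible -/

/-- Integration against a measure with finite support is a finite sum. -/
theorem integral_eq_sum_support {X : Type*} [TopologicalSpace X] [HereditarilyLindelofSpace X]
    [MeasurableSpace X] [MeasurableSingletonClass X] (μ : Measure X) [IsFiniteMeasure μ]
    (hfin : μ.support.Finite) (f : X → ℝ) :
    ∫ x, f x ∂μ = ∑ x ∈ hfin.toFinset, μ.real {x} * f x := by
  have hμ : μ.restrict (hfin.toFinset : Set X) = μ :=
    Measure.restrict_eq_self_of_ae_mem (by simpa using Measure.support_mem_ae)
  conv_lhs => rw [← hμ]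
  rw [setIntegral_finset _ IntegrableOn.finset]
  rfl

theorem IsEquilibrium.infinite_support_verifiers (hR : 0 < R) (hconvex : Convex ℝ S) {c : Plane}
    (hc : Metric.closedBall c R ⊆ S) {σv : ProbabilityMeasure (VerifierAction S R)}
    {σm : ProbabilityMeasure (MaliciousAction S)} (h : IsEquilibrium σv σm) :
    (σv : Measure (VerifierAction S R)).support.Infinite := by
  intro hfin
  have hf := integral_eq_sum_support (σv : Measure (VerifierAction S R)) hfin
  set p : VerifierAction S R → ℝ := fun a => (σv : Measure (VerifierAction S R)).real {a}
  set w := expected utilityM σv σm with hw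
  have hwpos : 0 < w := h.expected_pos hR hconvex hc
  have hle : ∀ b, ∑ a ∈ hfin.toFinset, p a * utilityM a b ≤ w := fun b => by
    rw [← hf fun a => utilityM a b]
    exact h.integral_le hR.le b
  obtain ⟨b, hb⟩ : ∃ b, w ≤ ∑ a ∈ hfin.toFinset, p a * utilityM a b := by
    have hint := (integrable_utilityM hR.le
      ((σv : Measure (VerifierAction S R)).prod (σm : Measure (MaliciousAction S)))
      ).integral_prod_right
    obtain ⟨b, hb⟩ := exists_integral_le hint
    refine ⟨b, ?_⟩
    rw [hw, expected_utilityM_eq_symm hR.le, ← hf fun a => utilityM a b]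
    exact hb
  obtain ⟨x, hx, hxd⟩ := exists_tendsto_dist_lt hR hconvex hc b
  have hev : ∀ᶠ n in atTop, ∀ a : hfin.toFinset, IsUnknown R a.1.1 b.1 b.2 →
      IsUnknown R a.1.1 (x n).1 (x n).2 := by
    refine eventually_all.2 fun a => eventually_imp_distrib_left.2 fun ha => ?_
    exact hx.eventually ((isOpen_setOf_isUnknown.preimage
      (Continuous.prodMk_right (a : VerifierAction S R))).mem_nhds ha)
  obtain ⟨n, hn⟩ := hev.exists
  have hlt : ∑ a ∈ hfin.toFinset, p a * utilityM a b
      < ∑ a ∈ hfin.toFinset, p a * utilityM a (x n) := by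
    -- As `w > 0`, some triple of positive weight yields UNKNOWN; it makes the gain strict.
    obtain ⟨a, ha, hpos⟩ := Finset.exists_lt_of_sum_lt (s := hfin.toFinset) (f := fun _ => (0 : ℝ))
      (g := fun a => p a * utilityM a b) (by simpa using hwpos.trans_le hb)
    have key : ∀ a ∈ hfin.toFinset, 0 < utilityM a b → utilityM a b < utilityM a (x n) := by
      intro a ha hpos
      have hu := utilityM_pos_iff.1 hpos
      rw [utilityM_of_isUnknown hu, utilityM_of_isUnknown (hn ⟨a, ha⟩ hu)]
      exact hxd (fun e => hu.ne (congrArg _ e)) hu.dist_lt n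
    refine Finset.sum_lt_sum (fun a ha => ?_) ⟨a, ha, ?_⟩
    · refine mul_le_mul_of_nonneg_left ?_ measureReal_nonneg
      rcases (utilityM_nonneg a b).eq_or_lt with h0 | h0
      · exact h0 ▸ utilityM_nonneg _ _
      · exact (key a ha h0).le
    · have hp : 0 < p a := pos_of_mul_pos_left hpos (utilityM_nonneg _ _)
      exact mul_lt_mul_of_pos_left (key a ha (pos_of_mul_pos_right hpos hp.le)) hp
  exact absurd (hb.trans_lt hlt) (not_lt.2 (hle (x n)))

theorem IsEquilibrium.infinite_support_malicious (hR : 0 < R) (hclosed : IsClosed S)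
    (hconvex : Convex ℝ S) {c : Plane} (hc : Metric.closedBall c R ⊆ S)
    {σv : ProbabilityMeasure (VerifierAction S R)} {σm : ProbabilityMeasure (MaliciousAction S)}
    (h : IsEquilibrium σv σm) : (σm : Measure (MaliciousAction S)).support.Infinite := by
  intro hfin
  have hg := integral_eq_sum_support (σm : Measure (MaliciousAction S)) hfin
  set F := hfin.toFinset
  set q : MaliciousAction S → ℝ := fun b => (σm : Measure (MaliciousAction S)).real {b}
  set w := expected utilityM σv σm with hw
  have hwpos : 0 < w := h.expected_pos hR hconvex hc
  have hge : ∀ a, w ≤ ∑ b ∈ F, q b * utilityM a b := fun a => by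
    rw [← hg fun b => utilityM a b]
    exact h.le_integral hR.le a
  have hq1 : ∑ b ∈ F, q b = 1 := by
    simpa only [mul_one, integral_const, probReal_univ, smul_eq_mul] using (hg fun _ => 1).symm
  have hactive : ∀ a : VerifierAction S R, ∃ b ∈ F, 0 < q b ∧ 0 < utilityM a b := by
    intro a
    obtain ⟨b, hb, hpos⟩ := Finset.exists_lt_of_sum_lt (s := F) (f := fun _ => (0 : ℝ))
      (g := fun b => q b * utilityM a b) (by simpa using hwpos.trans_le (hge a))
    have hp : 0 < q b := pos_of_mul_pos_left hpos (utilityM_nonneg _ _)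
    exact ⟨b, hb, hp, pos_of_mul_pos_right hpos hp.le⟩
  -- `S` may be unbounded, but every triple lies within `R` of one of the finitely many positions
  -- `P` in the support.
  have hcompact : IsCompact (univ : Set (VerifierAction S R)) := by
    have hset : IsClosed {V : Fin 3 → Plane | (∀ i, V i ∈ S) ∧ ∀ i j, dist (V i) (V j) ≤ R} := by
      simp only [ofPred_and, ofPred_forall]
      refine (isClosed_iInter fun i => hclosed.preimage (continuous_apply i)).inter
        (isClosed_iInter fun i => isClosed_iInter fun j => isClosed_le ?_ continuous_const)
      exact (continuous_apply i).dist (continuous_apply j)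
    have hcover : (univ : Set (VerifierAction S R)) ⊆ ⋃ b ∈ F,
        (Subtype.val : VerifierAction S R → _) ⁻¹' Metric.closedBall (fun _ => (b.2 : Plane)) R := by
      intro a _
      obtain ⟨b, hb, -, hu⟩ := hactive a
      refine mem_iUnion₂.2 ⟨b, hb, (dist_pi_le_iff hR.le).2 fun i => ?_⟩
      rw [dist_comm]
      exact (utilityM_pos_iff.1 hu i).1.le
    refine (F.isCompact_biUnion fun b _ => ?_).of_isClosed_subset isClosed_univ hcover
    exact hset.isClosedEmbedding_subtypeVal.isCompact_preimage (isCompact_closedBall _ _)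
  choose x hx hxd using exists_tendsto_dist_lt hR hconvex hc
  -- The triple varies together with the stretch: near `a`, every pair that is UNKNOWN at `a` stays
  -- so and pays more than at `a`.
  have hlocal : ∀ a ∈ (univ : Set (VerifierAction S R)),
      {z : ℕ × VerifierAction S R | w < ∑ b ∈ F, q b * utilityM z.2 (x b z.1)}
        ∈ atTop ×ˢ 𝓝 a := by
    intro a _
    have hev : ∀ᶠ z : ℕ × VerifierAction S R in atTop ×ˢ 𝓝 a, ∀ b : F,
        IsUnknown R a.1 b.1.1 b.1.2 → IsUnknown R z.2.1 (x b z.1).1 (x b z.1).2 := by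
      refine eventually_all.2 fun b => eventually_imp_distrib_left.2 fun hb => ?_
      have hlim : Tendsto (fun z : ℕ × VerifierAction S R => (z.2, x b z.1)) (atTop ×ˢ 𝓝 a)
          (𝓝 (a, (b : MaliciousAction S))) :=
        tendsto_snd.prodMk_nhds ((hx b).comp tendsto_fst)
      exact hlim.eventually (isOpen_setOf_isUnknown.mem_nhds hb)
    filter_upwards [hev] with z hz
    have key : ∀ b ∈ F, 0 < utilityM a b → utilityM a b < utilityM z.2 (x b z.1) := by
      intro b hb hpos
      have hu := utilityM_pos_iff.1 hpos
      rw [utilityM_of_isUnknown hu, utilityM_of_isUnknown (hz ⟨b, hb⟩ hu)]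
      exact hxd b (fun e => hu.ne (congrArg _ e)) hu.dist_lt _
    obtain ⟨b, hb, hqb, hub⟩ := hactive a
    refine (hge a).trans_lt (Finset.sum_lt_sum (fun b hb => ?_) ⟨b, hb, ?_⟩)
    · refine mul_le_mul_of_nonneg_left ?_ measureReal_nonneg
      rcases (utilityM_nonneg a b).eq_or_lt with h0 | h0
      · exact h0 ▸ utilityM_nonneg _ _
      · exact (key b hb h0).le
    · exact mul_lt_mul_of_pos_left (key b hb hub) hqb
  have hunif : ∀ᶠ n in atTop, ∀ a : VerifierAction S R, w < ∑ b ∈ F, q b * utilityM a (x b n) := by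
    have := hcompact.mem_prod_nhdsSet_of_forall hlocal
    rw [nhdsSet_univ, ← principal_univ] at this
    exact (eventually_prod_principal_iff.1 this).mono fun n hn a => hn a (mem_univ a)
  obtain ⟨n, hn⟩ := hunif.exists
  -- Averaged over `σv`, each stretched pair earns at most `w`, so some triple concedes at most `w`
  -- to the stretched mixture.
  have hint : Integrable (fun a => ∑ b ∈ F, q b * utilityM a (x b n))
      (σv : Measure (VerifierAction S R)) :=
    integrable_finsetSum _ fun b _ => (integrable_utilityM_left hR.le _ _).const_mul _
  obtain ⟨a, ha⟩ := exists_le_integral hint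
  refine absurd ((hn a).trans_le ha) (not_lt.2 ?_)
  rw [integral_finsetSum _ fun b _ => (integrable_utilityM_left hR.le _ _).const_mul _]
  calc ∑ b ∈ F, ∫ a, q b * utilityM a (x b n) ∂(σv : Measure (VerifierAction S R))
      ≤ ∑ b ∈ F, q b * w := Finset.sum_le_sum fun b _ => by
        rw [integral_const_mul]
        exact mul_le_mul_of_nonneg_left (h.integral_le hR.le _) measureReal_nonneg
    _ = w := by rw [← Finset.sum_mul, hq1, one_mul]

end SecureLocalization

end

theorem theorem4 (R : ℝ) (hR : 0 < R)
    (S : Set SecureLocalization.Plane) (hclosed : IsClosed S) (hconvex : Convex ℝ S)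
    (hlarge : ∃ c : SecureLocalization.Plane, Metric.closedBall c R ⊆ S)
    (σv : ProbabilityMeasure (SecureLocalization.VerifierAction S R))
    (σm : ProbabilityMeasure (SecureLocalization.MaliciousAction S))
    (hσ : SecureLocalization.IsEquilibrium σv σm) :
    (σv : Measure (SecureLocalization.VerifierAction S R)).support.Infinite ∧
      (σm : Measure (SecureLocalization.MaliciousAction S)).support.Infinite := by
  obtain ⟨c, hc⟩ := hlarge
  exact ⟨hσ.infinite_support_verifiers hR hconvex hc,
    hσ.infinite_support_malicious hR hclosed hconvex hc⟩
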